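/- Let $P$ be a set. A coloured $P$-multi-order is a many-sorted structure $A$ with one (possibly empty) sort $A_p$ for each $p\in P$, a binary relation $\leqslant_{p,q}$ between $A_p$ and $A_q$ for each $(p,q)\in P^2$, and an arbitrary collection of unary predicates (colours), such that each $\leqslant_{p,p}$ is a linear order on $A_p$ and $\bigcup_{p,q\in P}\leqslant_{p,q}$ is a total preorder on the disjoint union $\bigsqcup_{p\in P}A_p$. Such an $A$ is non-empty if some $A_p$ is non-empty. For coloured $P$-multi-orders $A,B$ with the same set of colours, the sum $A+B$ has components $A_p\sqcup B_p$, the relations and colours of $A$ and $B$ on the two copies, and every element of $A$ strictly below every element of $B$ (that is, $a\leqslant_{p,q} b$ and not $b\leqslant_{q,p} a$ for all $a\in A_p$, $b\in B_q$). We write $\preccurlyeq$ for "is an elementary substructure of" (many-sorted first-order logic, with respect to the canonical inclusions). We say that $A$ is augmentable on the right (resp. on the left) if there is a non-empty coloured $P$-multi-order $B$ with the same set of colours such that $A\preccurlyeq A+B$ (resp. $A\preccurlyeq B+A$). The component $A_p$ is bounded on the right (resp. on the left) if there are $q\in P$ and $a\in A_q$ with $x\leqslant_{p,q}a$ (resp.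 $a\leqslant_{q,p}x$) for all $x\in A_p$; otherwise it is unbounded on the right (resp. on the left). Let $A$ be a non-empty coloured $P$-multi-order. Then $A$ is augmentable on the right (resp. on the left) if and only if, for some $p\in P$, the component $A_p$ is unbounded on the right (resp. on the left). -/

import Mathlib

universe u v w w₁ w₂

/-- A coloured `P`-multi-order with colours `K`: for every sort `p : P` a component, for every pair
of sorts `(p, q)` a relation `le` between the components `p` and `q`, and for every colour
`c : K p` a unary predicate on the component `p`. All the relations `le` together form a linear
(that is, total) preorder on the disjoint union of the components, and each `le` from a component
to itself is a linear order. Components may be empty. A unary predicate on the whole disjoint union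
amounts to one colour for each sort. -/
structure ColouredMultiOrder (P : Type u) (K : P → Type v) where
  /-- The component of sort `p`. -/
  Carrier : P → Type w
  le : ∀ {p q : P}, Carrier p → Carrier q → Prop
  colour : ∀ {p : P}, K p → Carrier p → Prop
  le_refl : ∀ {p : P} (x : Carrier p), le x x
  le_trans : ∀ {p q r : P} (x : Carrier p) (y : Carrier q) (z : Carrier r),
    le x y → le y z → le x z
  le_total : ∀ {p q : P} (x : Carrier p) (y : Carrier q), le x y ∨ le y x
  le_antisymm : ∀ {p : P} (x y : Carrier p), le x y → le y x → x = y

namespace ColouredMultiOrder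

variable {P : Type u} {K : P → Type v}

/-- `Var Γ p` is the type of the variables of sort `p` in the context `Γ`, a finite list of sorts
(typed de Bruijn indices). -/
inductive Var {P : Type u} : List P → P → Type u
  | zero {Γ : List P} {p : P} : Var (p :: Γ) p
  | succ {Γ : List P} {p q : P} (x : Var Γ p) : Var (q :: Γ) p

/-- First-order (many-sorted) formulas in the language of coloured `P`-multi-orders with colours
`K`, whose free variables lie in the context `Γ`. The other connectives and the existential
quantifiers are definable from these in the usual way. -/
inductive Formula {P : Type u} (K : P → Type v) : List P → Type (max u v)
  | falsum {Γ : List P} : Formula K Γ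
  | equal {Γ : List P} {p : P} (x y : Var Γ p) : Formula K Γ
  | le {Γ : List P} {p q : P} (x : Var Γ p) (y : Var Γ q) : Formula K Γ
  | colour {Γ : List P} {p : P} (c : K p) (x : Var Γ p) : Formula K Γ
  | imp {Γ : List P} (φ ψ : Formula K Γ) : Formula K Γ
  | all {Γ : List P} (p : P) (φ : Formula K (p :: Γ)) : Formula K Γ

/-- An assignment of elements of `A` to the variables of a context, respecting sorts. -/
def Assignment (A : ColouredMultiOrder.{u, v, w} P K) (Γ : List P) : Type (max u w) :=
  ∀ p : P, Var Γ p → A.Carrier p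

/-- Extend an assignment by giving the value `a` to the newest variable. -/
def Assignment.cons {A : ColouredMultiOrder.{u, v, w} P K} {Γ : List P} {p : P}
    (a : A.Carrier p) (s : A.Assignment Γ) : A.Assignment (p :: Γ)
  | _, Var.zero => a
  | _, Var.succ x => s _ x

/-- Tarskian satisfaction; the quantifier `all p` ranges over the component of sort `p`. -/
def Realize (A : ColouredMultiOrder.{u, v, w} P K) :
    {Γ : List P} → Formula K Γ → A.Assignment Γ → Prop
  | _, Formula.falsum, _ => False
  | _, Formula.equal x y, s => s _ x = s _ y
  | _, Formula.le x y, s => A.le (s _ x) (s _ y)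
  | _, Formula.colour c x, s => A.colour c (s _ x)
  | _, Formula.imp φ ψ, s => A.Realize φ s → A.Realize ψ s
  | _, Formula.all p φ, s => ∀ a : A.Carrier p, A.Realize φ (Assignment.cons a s)

/-- A sort-preserving map `f : A → B` is elementary if it preserves the truth of every first-order
formula at every assignment. For an inclusion, this says that `A` is an elementary substructure
of `B`. -/
def IsElementary (A : ColouredMultiOrder.{u, v, w₁} P K) (B : ColouredMultiOrder.{u, v, w₂} P K)
    (f : ∀ p : P, A.Carrier p → B.Carrier p) : Prop :=
  ∀ (Γ : List P) (φ : Formula K Γ) (s : A.Assignment Γ),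
    B.Realize φ (fun p x => f p (s p x)) ↔ A.Realize φ s

/-- The sum `A + B`: a copy of `A` followed by a copy of `B`. -/
def add (A : ColouredMultiOrder.{u, v, w₁} P K) (B : ColouredMultiOrder.{u, v, w₂} P K) :
    ColouredMultiOrder.{u, v, max w₁ w₂} P K where
  Carrier p := A.Carrier p ⊕ B.Carrier p
  le
    | Sum.inl a, Sum.inl a' => A.le a a'
    | Sum.inl _, Sum.inr _ => True
    | Sum.inr _, Sum.inl _ => False
    | Sum.inr b, Sum.inr b' => B.le b b'
  colour
    | c, Sum.inl a => A.colour c a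
    | c, Sum.inr b => B.colour c b
  le_refl := by
    rintro p (x | x)
    · exact A.le_refl x
    · exact B.le_refl x
  le_trans := by
    rintro p q r (x | x) (y | y) (z | z) hxy hyz
    · exact A.le_trans x y z hxy hyz
    · trivial
    · exact hyz.elim
    · trivial
    · exact hxy.elim
    · exact hxy.elim
    · exact hyz.elim
    · exact B.le_trans x y z hxy hyz
  le_total := by
    rintro p q (x | x) (y | y)
    · exact A.le_total x y
    · exact Or.inl trivial
    · exact Or.inr trivial
    · exact B.le_total x y
  le_antisymm := by
    rintro p (x | x) (y | y) hxy hyx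
    · exact congrArg Sum.inl (A.le_antisymm x y hxy hyx)
    · exact hyx.elim
    · exact hxy.elim
    · exact congrArg Sum.inr (B.le_antisymm x y hxy hyx)

/-- A multi-order is non-empty if some component of it has an element. -/
def IsNonempty (A : ColouredMultiOrder.{u, v, w} P K) : Prop :=
  ∃ p : P, Nonempty (A.Carrier p)

/-- `A ≼ A + B`, along the canonical inclusion. -/
def AugmentableRightBy (A : ColouredMultiOrder.{u, v, w₁} P K)
    (B : ColouredMultiOrder.{u, v, w₂} P K) : Prop :=
  IsElementary A (A.add B) (fun _ => Sum.inl)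

/-- `A ≼ B + A`, along the canonical inclusion. -/
def AugmentableLeftBy (A : ColouredMultiOrder.{u, v, w₁} P K)
    (B : ColouredMultiOrder.{u, v, w₂} P K) : Prop :=
  IsElementary A (B.add A) (fun _ => Sum.inr)

/-- `A ≼ A + B` for some non-empty coloured `P`-multi-order `B` with the same colours. -/
def AugmentableRight (A : ColouredMultiOrder.{u, v, w} P K) : Prop :=
  ∃ B : ColouredMultiOrder.{u, v, max u v w} P K, B.IsNonempty ∧ A.AugmentableRightBy B

/-- `A ≼ B + A` for some non-empty coloured `P`-multi-order `B` with the same colours. -/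
def AugmentableLeft (A : ColouredMultiOrder.{u, v, w} P K) : Prop :=
  ∃ B : ColouredMultiOrder.{u, v, max u v w} P K, B.IsNonempty ∧ A.AugmentableLeftBy B

/-- The component `A_p` has an upper bound in `A`, possibly of another sort. -/
def BoundedRight (A : ColouredMultiOrder.{u, v, w} P K) (p : P) : Prop :=
  ∃ (q : P) (a : A.Carrier q), ∀ x : A.Carrier p, A.le x a

/-- The component `A_p` has a lower bound in `A`, possibly of another sort. -/
def BoundedLeft (A : ColouredMultiOrder.{u, v, w} P K) (p : P) : Prop :=
  ∃ (q : P) (a : A.Carrier q), ∀ x : A.Carrier p, A.le a x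

end ColouredMultiOrder

/-! An upper bound for sort `p` is a first-order statement about the bound, so it survives in `A +
B` and rules out elements of sort `p` in `B`. Hence augmentability yields an unbounded component.

Conversely, if `A_p` is unbounded, an ultrapower `M` of `A` has an element of sort `p` above all of
`A` (`exists_isElementary_above`). Let `B` be the part of `M` above `A`; elements of `M` outside `A`
but below some element of `A` are discarded. The key claim is `A + B ≼ M` (`isElementary_addAbove`);
with `A ≼ M` it gives `A ≼ A + B`. It rests on `exists_finite_traces`: below a point `a`, parameters
above `a` define nothing new, as their effect is captured by a formula over `a` and the parameters
below. A Tarski–Vaught counterexample not above `A` can thus be described with parameters in `A`,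
and `A ≼ M` moves it into `A`.

The left-hand statement follows by reversing the order. -/

namespace ColouredMultiOrder

variable {P : Type u} {K : P → Type v}

/-! ### Derived connectives, order reversal of formulas, and assignments. -/

namespace Formula

/-- Negation. -/
def neg {Γ : List P} (φ : Formula K Γ) : Formula K Γ := imp φ falsum

/-- Conjunction. -/
def and {Γ : List P} (φ ψ : Formula K Γ) : Formula K Γ := neg (imp φ (neg ψ))

/-- The conjunction of a list of formulas. -/
def conj {Γ : List P} : List (Formula K Γ) → Formula K Γ
  | [] => neg falsum
  | φ :: l => and φ (conj l)

/-- The formula obtained by reversing the order. -/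
def op : {Γ : List P} → Formula K Γ → Formula K Γ
  | _, falsum => falsum
  | _, equal x y => equal x y
  | _, le x y => le y x
  | _, colour c x => colour c x
  | _, imp φ ψ => imp φ.op ψ.op
  | _, all p φ => all p φ.op

end Formula

section Realize

variable (A : ColouredMultiOrder.{u, v, w} P K)

@[simp] theorem realize_neg {Γ : List P} (φ : Formula K Γ) (s : A.Assignment Γ) :
    A.Realize φ.neg s ↔ ¬ A.Realize φ s := Iff.rfl

@[simp] theorem realize_and {Γ : List P} (φ ψ : Formula K Γ) (s : A.Assignment Γ) :
    A.Realize (φ.and ψ) s ↔ A.Realize φ s ∧ A.Realize ψ s := by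
  simp only [Formula.and, realize_neg, Realize]
  tauto

theorem realize_conj {Γ : List P} (l : List (Formula K Γ)) (s : A.Assignment Γ) :
    A.Realize (Formula.conj l) s ↔ ∀ φ ∈ l, A.Realize φ s := by
  induction l with
  | nil => simp [Formula.conj, Realize]
  | cons φ l ih => simp [Formula.conj, ih]

/-- The unique assignment in the empty context. -/
def Assignment.nil : A.Assignment [] := fun _ x => nomatch x

end Realize

theorem Assignment.map_cons {A : ColouredMultiOrder.{u, v, w₁} P K}
    {B : ColouredMultiOrder.{u, v, w₂} P K} (f : ∀ p : P, A.Carrier p → B.Carrier p)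
    {Γ : List P} {p : P} (a : A.Carrier p) (s : A.Assignment Γ) :
    (fun r x => f r (Assignment.cons a s r x) : B.Assignment (p :: Γ)) =
      Assignment.cons (f p a) (fun r x => f r (s r x)) := by
  funext r x
  cases x <;> rfl

/-! ### Elementary maps -/

section Elementary

variable {A : ColouredMultiOrder.{u, v, w} P K} {B : ColouredMultiOrder.{u, v, w₁} P K}
  {C : ColouredMultiOrder.{u, v, w₂} P K}

theorem IsElementary.of_comp {f : ∀ p : P, A.Carrier p → B.Carrier p}
    {g : ∀ p : P, B.Carrier p → C.Carrier p} (hg : IsElementary B C g)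
    (h : IsElementary A C (fun p x => g p (f p x))) : IsElementary A B f :=
  fun Γ φ s => (hg Γ φ (fun p x => f p (s p x))).symm.trans (h Γ φ s)

theorem IsElementary.comp {f : ∀ p : P, A.Carrier p → B.Carrier p}
    {g : ∀ p : P, B.Carrier p → C.Carrier p} (hg : IsElementary B C g)
    (hf : IsElementary A B f) : IsElementary A C (fun p x => g p (f p x)) :=
  fun Γ φ s => (hg Γ φ (fun p x => f p (s p x))).trans (hf Γ φ s)

theorem IsElementary.le_iff {f : ∀ p : P, A.Carrier p → B.Carrier p} (hf : IsElementary A B f)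
    {p q : P} (x : A.Carrier p) (y : A.Carrier q) : B.le (f p x) (f q y) ↔ A.le x y :=
  hf [p, q] (.le .zero (.succ .zero))
    (Assignment.cons x (Assignment.cons y (Assignment.nil A)))

theorem IsElementary.colour_iff {f : ∀ p : P, A.Carrier p → B.Carrier p}
    (hf : IsElementary A B f) {p : P} (c : K p) (x : A.Carrier p) :
    B.colour c (f p x) ↔ A.colour c x :=
  hf [p] (.colour c .zero) (Assignment.cons x (Assignment.nil A))

/-- The Tarski–Vaught test. -/
theorem isElementary_of_tarskiVaught (f : ∀ p : P, A.Carrier p → B.Carrier p)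
    (hle : ∀ {p q : P} (x : A.Carrier p) (y : A.Carrier q), B.le (f p x) (f q y) ↔ A.le x y)
    (hcol : ∀ {p : P} (c : K p) (x : A.Carrier p), B.colour c (f p x) ↔ A.colour c x)
    (htv : ∀ (Γ : List P) (p : P) (φ : Formula K (p :: Γ)) (s : A.Assignment Γ),
      (∀ x : A.Carrier p, B.Realize φ (Assignment.cons (f p x) (fun r y => f r (s r y)))) →
      ∀ x : B.Carrier p, B.Realize φ (Assignment.cons x (fun r y => f r (s r y)))) :
    IsElementary A B f := by
  intro Γ φ
  induction φ with
  | falsum => exact fun s => Iff.rfl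
  | equal x y =>
    intro s
    refine ⟨fun h => ?_, fun h => congrArg (f _) h⟩
    change f _ _ = f _ _ at h
    -- Injectivity is not assumed: it follows from order reflection and antisymmetry within a sort.
    exact A.le_antisymm _ _ ((hle _ _).1 (h ▸ B.le_refl _)) ((hle _ _).1 (h ▸ B.le_refl _))
  | le x y => exact fun s => hle _ _
  | colour c x => exact fun s => hcol _ _
  | imp φ ψ ihφ ihψ => exact fun s => imp_congr (ihφ s) (ihψ s)
  | all p φ ih =>
    intro s
    have key : ∀ x : A.Carrier p,
        B.Realize φ (Assignment.cons (f p x) (fun r y => f r (s r y))) ↔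
          A.Realize φ (Assignment.cons x s) := fun x => by
      rw [← Assignment.map_cons]
      exact ih _
    exact ⟨fun h x => (key x).1 (h _), fun h => htv _ p φ s fun x => (key x).2 (h x)⟩

theorem isElementary_of_surjective (f : ∀ p : P, A.Carrier p → B.Carrier p)
    (hle : ∀ {p q : P} (x : A.Carrier p) (y : A.Carrier q), B.le (f p x) (f q y) ↔ A.le x y)
    (hcol : ∀ {p : P} (c : K p) (x : A.Carrier p), B.colour c (f p x) ↔ A.colour c x)
    (hsurj : ∀ p, Function.Surjective (f p)) : IsElementary A B f :=
  isElementary_of_tarskiVaught f hle hcol fun _ p _ _ h x => by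
    obtain ⟨y, rfl⟩ := hsurj p x
    exact h y

end Elementary

/-! ### Ultrapowers -/

section Ultrapower

variable {I : Type w₁} (U : Ultrafilter I) (A : ColouredMultiOrder.{u, v, w} P K)

/-- The ultrapower of `A` by the ultrafilter `U`. -/
def ultrapower : ColouredMultiOrder.{u, v, max w₁ w} P K where
  Carrier p := Filter.Germ (U : Filter I) (A.Carrier p)
  le x y := Filter.Germ.LiftRel A.le x y
  colour c x := Filter.Germ.LiftPred (A.colour c) x
  le_refl x := by
    induction x using Filter.Germ.inductionOn with | _ x =>
    exact Filter.Eventually.of_forall fun i => A.le_refl (x i)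
  le_trans x y z := by
    induction x using Filter.Germ.inductionOn with | _ x =>
    induction y using Filter.Germ.inductionOn with | _ y =>
    induction z using Filter.Germ.inductionOn with | _ z =>
    intro hxy hyz
    rw [Filter.Germ.liftRel_coe] at *
    filter_upwards [hxy, hyz] with i using A.le_trans _ _ _
  le_total x y := by
    induction x using Filter.Germ.inductionOn with | _ x =>
    induction y using Filter.Germ.inductionOn with | _ y =>
    exact Ultrafilter.eventually_or.1 (Filter.Eventually.of_forall fun i => A.le_total (x i) (y i))
  le_antisymm x y := by
    induction x using Filter.Germ.inductionOn with | _ x =>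
    induction y using Filter.Germ.inductionOn with | _ y =>
    intro hxy hyx
    rw [Filter.Germ.liftRel_coe] at *
    refine Filter.Germ.coe_eq.2 ?_
    filter_upwards [hxy, hyx] with i using A.le_antisymm _ _

/-- Łoś's theorem. -/
theorem realize_ultrapower {Γ : List P} (φ : Formula K Γ)
    (s : ∀ p : P, Var Γ p → I → A.Carrier p) :
    (A.ultrapower U).Realize φ (fun p x => (s p x : Filter.Germ (U : Filter I) (A.Carrier p))) ↔
      ∀ᶠ i in (U : Filter I), A.Realize φ (fun p x => s p x i) := by
  induction φ with
  | falsum => exact (Filter.eventually_false_iff_eq_bot.trans (iff_false_intro U.neBot.ne)).symm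
  | equal x y => exact Filter.Germ.coe_eq
  | le x y => exact Iff.rfl
  | colour c x => exact Iff.rfl
  | imp φ ψ ihφ ihψ =>
    simp only [Realize]
    rw [Ultrafilter.eventually_imp, ihφ, ihψ]
  | @all Γ' p φ ih =>
    let t (a : I → A.Carrier p) : ∀ r : P, Var (p :: Γ') r → I → A.Carrier r := fun r x i =>
      Assignment.cons (a i) (fun r x => s r x i : A.Assignment Γ') r x
    have key (a : I → A.Carrier p) : (A.ultrapower U).Realize φ
        (Assignment.cons (A := A.ultrapower U) (a : Filter.Germ (U : Filter I) (A.Carrier p))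
          (fun p x => (s p x : Filter.Germ (U : Filter I) (A.Carrier p)))) ↔
        ∀ᶠ i in (U : Filter I), A.Realize φ (Assignment.cons (a i) (fun r x => s r x i)) := by
      rw [← ih (t a)]
      refine iff_of_eq (congrArg _ ?_)
      funext r x
      cases x <;> rfl
    simp only [Realize]
    constructor
    · intro h
      by_contra hn
      rw [← Ultrafilter.eventually_not] at hn
      simp only [not_forall] at hn
      obtain ⟨i, hi⟩ := hn.exists
      -- Choosing failing witnesses needs a default value at the remaining indices.
      have : Nonempty (A.Carrier p) := ⟨hi.choose⟩
      obtain ⟨a, ha⟩ := hn.choice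
      obtain ⟨i, h₁, h₂⟩ := (ha.and ((key a).1 (h _))).exists
      exact h₁ h₂
    · intro h a
      induction a using Filter.Germ.inductionOn with | _ a =>
      exact (key a).2 (h.mono fun i hi => hi _)

theorem isElementary_ultrapower :
    IsElementary A (A.ultrapower U) (fun _ x => ((fun _ => x : I → _) : Filter.Germ _ _)) :=
  fun _ φ s => (A.realize_ultrapower U φ (fun p x _ => s p x)).trans Filter.eventually_const

end Ultrapower

/-- If a component of `A` is unbounded, some elementary extension of `A` has an element of that
sort above `A`. -/
theorem exists_isElementary_above (A : ColouredMultiOrder.{u, v, w} P K) (hA : A.IsNonempty)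
    {p : P} (hp : ¬ A.BoundedRight p) :
    ∃ (M : ColouredMultiOrder.{u, v, w} P K) (f : ∀ q : P, A.Carrier q → M.Carrier q),
      IsElementary A M f ∧ ∃ b : M.Carrier p, ∀ (q : P) (a : A.Carrier q), ¬ M.le b (f q a) := by
  simp only [BoundedRight, not_exists, not_forall] at hp
  let _ : Preorder (A.Carrier p) :=
    { le := A.le, le_refl := A.le_refl, le_trans := A.le_trans }
  have : IsDirectedOrder (A.Carrier p) := ⟨fun x y =>
    (A.le_total x y).elim (fun h => ⟨y, h, A.le_refl y⟩) (fun h => ⟨x, A.le_refl x, h⟩)⟩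
  -- An empty component would be bounded by any element of `A`.
  have : Nonempty (A.Carrier p) := by
    obtain ⟨q, ⟨a⟩⟩ := hA
    exact ⟨(hp q a).choose⟩
  -- `U` contains every final segment of `A_p`, so the germ of the identity exceeds everything in
  -- `A`.
  let U : Ultrafilter (A.Carrier p) := Ultrafilter.of Filter.atTop
  refine ⟨A.ultrapower U, _, A.isElementary_ultrapower U,
    ((fun x => x : A.Carrier p → A.Carrier p) : Filter.Germ _ _), fun q a h => ?_⟩
  obtain ⟨x, hx⟩ := hp q a
  have hU : ∀ᶠ y in (U : Filter (A.Carrier p)), A.le x y :=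
    Ultrafilter.of_le Filter.atTop (Filter.eventually_ge_atTop x)
  have h' : ∀ᶠ y in (U : Filter (A.Carrier p)), A.le y a := h
  obtain ⟨y, h₁, h₂⟩ := (hU.and h').exists
  exact hx (A.le_trans _ _ _ h₁ h₂)

/-! ### Traces of definable sets on initial segments -/

section Traces

variable (M : ColouredMultiOrder.{u, v, w} P K)

/-- The assignment in `Γ` whose values are taken from `s` or `t`, as prescribed by `D`. -/
def mergeAssignment {Γ Δ E : List P} (D : ∀ p : P, Var Γ p → Var Δ p ⊕ Var E p)
    (s : M.Assignment Δ) (t : M.Assignment E) : M.Assignment Γ :=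
  fun p x => Sum.elim (s p) (t p) (D p x)

/-- Add a new variable on the left of a splitting of a context. -/
def splitConsLeft {Γ Δ E : List P} (D : ∀ p : P, Var Γ p → Var Δ p ⊕ Var E p) (r : P) :
    ∀ p : P, Var (r :: Γ) p → Var (r :: Δ) p ⊕ Var E p
  | _, .zero => .inl .zero
  | _, .succ x => (D _ x).map .succ id

/-- Add a new variable on the right of a splitting of a context. -/
def splitConsRight {Γ Δ E : List P} (D : ∀ p : P, Var Γ p → Var Δ p ⊕ Var E p) (r : P) :
    ∀ p : P, Var (r :: Γ) p → Var Δ p ⊕ Var (r :: E) p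
  | _, .zero => .inr .zero
  | _, .succ x => (D _ x).map id .succ

theorem mergeAssignment_consLeft {Γ Δ E : List P} (D : ∀ p : P, Var Γ p → Var Δ p ⊕ Var E p)
    (s : M.Assignment Δ) (t : M.Assignment E) {r : P} (a : M.Carrier r) :
    M.mergeAssignment (splitConsLeft D r) (Assignment.cons a s) t =
      Assignment.cons a (M.mergeAssignment D s t) := by
  funext p x
  cases x with
  | zero => rfl
  | succ x =>
    simp only [mergeAssignment, splitConsLeft, Assignment.cons]
    cases D p x <;> rfl

theorem mergeAssignment_consRight {Γ Δ E : List P} (D : ∀ p : P, Var Γ p → Var Δ p ⊕ Var E p)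
    (s : M.Assignment Δ) (t : M.Assignment E) {r : P} (a : M.Carrier r) :
    M.mergeAssignment (splitConsRight D r) s (Assignment.cons a t) =
      Assignment.cons a (M.mergeAssignment D s t) := by
  funext p x
  cases x with
  | zero => rfl
  | succ x =>
    simp only [mergeAssignment, splitConsRight, Assignment.cons]
    cases D p x <;> rfl

/-- For a formula `φ` and an element `a`, finitely many formulas with the parameter `a` (the value
of the variable `z`) suffice to define the traces on the initial segment `{x | x ≤ a}` of the sets
defined by `φ` with parameters above `a`. -/
theorem exists_finite_traces {q : P} (a : M.Carrier q) {Γ : List P} (φ : Formula K Γ) :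
    ∀ {Δ E : List P} (z : Var Δ q) (D : ∀ p : P, Var Γ p → Var Δ p ⊕ Var E p),
      ∃ l : List (Formula K Δ), ∀ t : M.Assignment E, (∀ p x, ¬ M.le (t p x) a) →
        ∃ α ∈ l, ∀ s : M.Assignment Δ, s q z = a → (∀ p x, M.le (s p x) a) →
          (M.Realize φ (M.mergeAssignment D s t) ↔ M.Realize α s) := by
  induction φ with
  | falsum =>
    exact fun z D => ⟨[.falsum], fun t _ => ⟨_, List.mem_singleton_self _, fun s _ _ => Iff.rfl⟩⟩
  | @equal Γ p x y =>
    intro Δ E z D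
    rcases hx : D _ x with x' | x' <;> rcases hy : D _ y with y' | y'
    · refine ⟨[.equal x' y'], fun t _ => ⟨_, List.mem_singleton_self _, fun s _ _ => ?_⟩⟩
      simp [Realize, mergeAssignment, hx, hy]
    · refine ⟨[.falsum], fun t ht => ⟨_, List.mem_singleton_self _, fun s _ hs => ?_⟩⟩
      simp only [Realize, mergeAssignment, hx, hy, Sum.elim_inl, Sum.elim_inr, iff_false]
      exact fun h => ht _ y' (h ▸ hs _ x')
    · refine ⟨[.falsum], fun t ht => ⟨_, List.mem_singleton_self _, fun s _ hs => ?_⟩⟩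
      simp only [Realize, mergeAssignment, hx, hy, Sum.elim_inl, Sum.elim_inr, iff_false]
      exact fun h => ht _ x' (h ▸ hs _ y')
    -- The truth value depends on `t` alone, so two constant formulas suffice.
    · refine ⟨[.falsum, .neg .falsum], fun t _ => ?_⟩
      by_cases h : t _ x' = t _ y'
      · exact ⟨.neg .falsum, by simp, fun s _ _ => by simp [Realize, mergeAssignment, hx, hy, h]⟩
      · exact ⟨.falsum, by simp, fun s _ _ => by simp [Realize, mergeAssignment, hx, hy, h]⟩
  | @le Γ p p' x y =>
    intro Δ E z D
    rcases hx : D _ x with x' | x' <;> rcases hy : D _ y with y' | y'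
    · refine ⟨[.le x' y'], fun t _ => ⟨_, List.mem_singleton_self _, fun s _ _ => ?_⟩⟩
      simp [Realize, mergeAssignment, hx, hy]
    · refine ⟨[.neg .falsum], fun t ht => ⟨_, List.mem_singleton_self _, fun s _ hs => ?_⟩⟩
      simp only [Realize, mergeAssignment, hx, hy, Sum.elim_inl, Sum.elim_inr, realize_neg,
        not_false_eq_true, iff_true]
      exact M.le_trans _ _ _ (hs _ x') ((M.le_total _ _).resolve_left (ht _ y'))
    · refine ⟨[.falsum], fun t ht => ⟨_, List.mem_singleton_self _, fun s _ hs => ?_⟩⟩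
      simp only [Realize, mergeAssignment, hx, hy, Sum.elim_inl, Sum.elim_inr, iff_false]
      exact fun h => ht _ x' (M.le_trans _ _ _ h (hs _ y'))
    · refine ⟨[.falsum, .neg .falsum], fun t _ => ?_⟩
      by_cases h : M.le (t _ x') (t _ y')
      · exact ⟨.neg .falsum, by simp, fun s _ _ => by simp [Realize, mergeAssignment, hx, hy, h]⟩
      · exact ⟨.falsum, by simp, fun s _ _ => by simp [Realize, mergeAssignment, hx, hy, h]⟩
  | @colour Γ p c x =>
    intro Δ E z D
    rcases hx : D _ x with x' | x'
    · refine ⟨[.colour c x'], fun t _ => ⟨_, List.mem_singleton_self _, fun s _ _ => ?_⟩⟩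
      simp [Realize, mergeAssignment, hx]
    · refine ⟨[.falsum, .neg .falsum], fun t _ => ?_⟩
      by_cases h : M.colour c (t _ x')
      · exact ⟨.neg .falsum, by simp, fun s _ _ => by simp [Realize, mergeAssignment, hx, h]⟩
      · exact ⟨.falsum, by simp, fun s _ _ => by simp [Realize, mergeAssignment, hx, h]⟩
  | imp φ ψ ihφ ihψ =>
    intro Δ E z D
    obtain ⟨l₁, h₁⟩ := ihφ z D
    obtain ⟨l₂, h₂⟩ := ihψ z D
    refine ⟨(l₁ ×ˢ l₂).map fun αβ => .imp αβ.1 αβ.2, fun t ht => ?_⟩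
    obtain ⟨α, hα, hα'⟩ := h₁ t ht
    obtain ⟨β, hβ, hβ'⟩ := h₂ t ht
    exact ⟨.imp α β, List.mem_map.2 ⟨(α, β), List.mem_product.2 ⟨hα, hβ⟩, rfl⟩,
      fun s hz hs => imp_congr (hα' s hz hs) (hβ' s hz hs)⟩
  | @all Γ r φ ih =>
    intro Δ E z D
    obtain ⟨l₁, h₁⟩ := ih z.succ (splitConsLeft D r)
    obtain ⟨l₂, h₂⟩ := ih z (splitConsRight D r)
    -- Quantification over elements up to `a` is relativised through `z`. Elements above `a` join
    -- `t` and contribute only traces from `l₂`, so all that matters is which sublist of `l₂`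
    -- occurs; there are finitely many.
    refine ⟨(l₁ ×ˢ l₂.sublists).map fun αl =>
      (Formula.all r (.imp (.le .zero z.succ) αl.1)).and (.conj αl.2), fun t ht => ?_⟩
    obtain ⟨α, hα, hα'⟩ := h₁ t ht
    have h₂' (b : M.Carrier r) (hb : ¬ M.le b a) := h₂ (Assignment.cons b t) (by
      intro p x
      cases x with
      | zero => exact hb
      | succ x => exact ht p x)
    classical
    -- The traces attained by some `b` above `a`, for this `t`.
    let l := l₂.filter fun β => ∃ b : M.Carrier r, ¬ M.le b a ∧ ∀ s : M.Assignment Δ, s q z = a →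
      (∀ p x, M.le (s p x) a) →
      (M.Realize φ (M.mergeAssignment (splitConsRight D r) s (Assignment.cons b t)) ↔
        M.Realize β s)
    refine ⟨_, List.mem_map.2 ⟨(α, l), List.mem_product.2
      ⟨hα, List.mem_sublists.2 List.filter_sublist⟩, rfl⟩, fun s hz hs => ?_⟩
    rw [realize_and, realize_conj]
    have hleft (b : M.Carrier r) (hb : M.le b a) :
        M.Realize φ (Assignment.cons b (M.mergeAssignment D s t)) ↔
          M.Realize α (Assignment.cons b s) := by
      rw [← mergeAssignment_consLeft]
      refine hα' _ hz fun p x => ?_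
      cases x with
      | zero => exact hb
      | succ x => exact hs p x
    constructor
    · refine fun h => ⟨fun b hb => (hleft b ?_).1 (h b), fun β hβ => ?_⟩
      · rw [← hz]; exact hb
      · obtain ⟨-, hβ⟩ := List.mem_filter.1 hβ
        obtain ⟨b, -, hb'⟩ := of_decide_eq_true hβ
        rw [← hb' s hz hs, mergeAssignment_consRight]
        exact h b
    · rintro ⟨hl, hr⟩ b
      by_cases hb : M.le b a
      · refine (hleft b hb).2 (hl b ?_)
        change M.le b (s q z)
        rwa [hz]
      · obtain ⟨β, hβ, hβ'⟩ := h₂' b hb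
        rw [← mergeAssignment_consRight, hβ' s hz hs]
        exact hr β (List.mem_filter.2 ⟨hβ, decide_eq_true ⟨b, hb, hβ'⟩⟩)

end Traces

/-! ### The part of an extension above `A` -/

section Above

variable {A : ColouredMultiOrder.{u, v, w} P K} {M : ColouredMultiOrder.{u, v, w} P K}

/-- The substructure of `M` whose elements lie above the image of `A`. -/
def above (f : ∀ p : P, A.Carrier p → M.Carrier p) : ColouredMultiOrder.{u, v, w} P K where
  Carrier p := {b : M.Carrier p // ∀ (q : P) (a : A.Carrier q), ¬ M.le b (f q a)}
  le x y := M.le x.1 y.1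
  colour c x := M.colour c x.1
  le_refl x := M.le_refl x.1
  le_trans x y z := M.le_trans x.1 y.1 z.1
  le_total x y := M.le_total x.1 y.1
  le_antisymm x y h h' := Subtype.ext (M.le_antisymm x.1 y.1 h h')

theorem exists_upperBound {Γ : List P} (s : A.Assignment Γ) {p : P} (a : A.Carrier p) :
    ∃ (q : P) (b : A.Carrier q), A.le a b ∧ ∀ r x, A.le (s r x) b := by
  induction Γ with
  | nil => exact ⟨p, a, A.le_refl a, fun _ x => by cases x⟩
  | cons r Γ ih =>
    obtain ⟨q, b, hab, hb⟩ := ih fun p x => s p x.succ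
    rcases A.le_total b (s r .zero) with h | h
    · refine ⟨r, s r .zero, A.le_trans _ _ _ hab h, fun p x => ?_⟩
      cases x with
      | zero => exact A.le_refl _
      | succ x => exact A.le_trans _ _ _ (hb p x) h
    · refine ⟨q, b, hab, fun p x => ?_⟩
      cases x with
      | zero => exact h
      | succ x => exact hb p x

/-- The map from `A + above f` to `M` given by `f` and the inclusion. -/
def addAbove (f : ∀ p : P, A.Carrier p → M.Carrier p) (p : P) :
    (A.add (above f)).Carrier p → M.Carrier p :=
  Sum.elim (f p) Subtype.val

/-- Separates the parameters from `A` from those above it, to match the form of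
`exists_finite_traces`. -/
theorem exists_split (f : ∀ p : P, A.Carrier p → M.Carrier p) {Γ : List P}
    (s : (A.add (above f)).Assignment Γ) :
    ∃ (Δ E : List P) (D : ∀ p : P, Var Γ p → Var Δ p ⊕ Var E p) (s₁ : A.Assignment Δ)
      (t : M.Assignment E), (∀ p x q (a : A.Carrier q), ¬ M.le (t p x) (f q a)) ∧
      (fun p x => addAbove f p (s p x)) = M.mergeAssignment D (fun p x => f p (s₁ p x)) t := by
  induction Γ with
  | nil =>
    refine ⟨[], [], fun _ x => .inl x, .nil A, .nil M, fun _ x => (by cases x), ?_⟩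
    funext _ x
    cases x
  | cons r Γ ih =>
    obtain ⟨Δ, E, D, s₁, t, ht, h⟩ := ih fun p x => s p x.succ
    rcases hr : s r .zero with a | b
    · refine ⟨r :: Δ, E, splitConsLeft D r, Assignment.cons a s₁, t, ht, ?_⟩
      refine Eq.trans ?_ ((congrArg (M.mergeAssignment _ · t) (Assignment.map_cons f a s₁)).trans
        (M.mergeAssignment_consLeft D _ t (f r a))).symm
      rw [← h]
      funext p x
      cases x with
      | zero => rw [hr]; rfl
      | succ x => rfl
    · refine ⟨Δ, r :: E, splitConsRight D r, s₁, Assignment.cons b.1 t, ?_, ?_⟩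
      · intro p x
        cases x with
        | zero => exact b.2
        | succ x => exact ht p x
      · refine Eq.trans ?_ (M.mergeAssignment_consRight D _ t b.1).symm
        rw [← h]
        funext p x
        cases x with
        | zero => rw [hr]; rfl
        | succ x => rfl

theorem isElementary_addAbove {f : ∀ p : P, A.Carrier p → M.Carrier p}
    (hf : IsElementary A M f) : IsElementary (A.add (above f)) M (addAbove f) := by
  refine isElementary_of_tarskiVaught _ ?_ ?_ ?_
  · rintro p q (x | x) (y | y)
    · exact hf.le_iff x y
    · exact iff_of_true ((M.le_total _ _).resolve_left (y.2 p x)) trivial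
    · exact iff_of_false (x.2 q y) id
    · exact Iff.rfl
  · rintro p c (x | x)
    · exact hf.colour_iff c x
    · exact Iff.rfl
  · intro Γ p φ s h c
    by_cases hc : ∀ (q : P) (a : A.Carrier q), ¬ M.le c (f q a)
    · exact h (.inr ⟨c, hc⟩)
    push Not at hc
    obtain ⟨q₀, a₀, hca₀⟩ := hc
    obtain ⟨Δ, E, D, s₁, t, ht, hs⟩ := exists_split f s
    -- One `a` in `A` bounds both `c` and all parameters from `A`; it is then added to the context
    -- as a parameter.
    obtain ⟨q, a, haa, hs₁⟩ := exists_upperBound s₁ a₀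
    have hca : M.le c (f q a) := M.le_trans _ _ _ hca₀ ((hf.le_iff _ _).2 haa)
    let D' : ∀ r : P, Var Γ r → Var (q :: Δ) r ⊕ Var E r := fun r x => (D r x).map .succ id
    let s' : A.Assignment (q :: Δ) := Assignment.cons a s₁
    have hs' : ∀ r x, A.le (s' r x) a := fun r x => by
      cases x with
      | zero => exact A.le_refl a
      | succ x => exact hs₁ r x
    have hmerge : (fun r x => addAbove f r (s r x)) =
        M.mergeAssignment D' (fun r x => f r (s' r x)) t := by
      rw [hs]
      funext r x
      simp only [mergeAssignment, D']
      cases D r x <;> rfl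
    -- Variable 0 is the quantified element, variable 1 is `a`.
    obtain ⟨l, hl⟩ := M.exists_finite_traces (f q a) φ (Var.succ (q := p) Var.zero)
      (splitConsLeft D' p)
    obtain ⟨α, -, hα⟩ := hl t fun r x => ht r x q a
    have key (b : M.Carrier p) (hb : M.le b (f q a)) :
        M.Realize φ (Assignment.cons b fun r x => addAbove f r (s r x)) ↔
          M.Realize α (Assignment.cons b fun r x => f r (s' r x)) := by
      rw [hmerge]
      refine (iff_of_eq (congrArg (M.Realize φ)
        (M.mergeAssignment_consLeft D' _ t b).symm)).trans (hα _ rfl fun r x => ?_)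
      cases x with
      | zero => exact hb
      | succ x => exact (hf.le_iff _ _).2 (hs' r x)
    -- "`α` holds for every element of sort `p` up to `a`" has parameters in `A` only, so checking
    -- it in `A` suffices.
    refine (key c hca).2 ((hf _ (.all p (.imp (.le .zero (.succ .zero)) α)) s').2 ?_ c hca)
    intro b hb
    rw [← hf _ α, Assignment.map_cons]
    exact (key (f p b) ((hf.le_iff _ _).2 hb)).1 (h (.inl b))

end Above

/-! ### Augmentability on the right -/

/-- A copy of `B` in a larger universe. -/
def ulift (B : ColouredMultiOrder.{u, v, w} P K) : ColouredMultiOrder.{u, v, max w w₁} P K where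
  Carrier p := ULift.{w₁} (B.Carrier p)
  le x y := B.le x.down y.down
  colour c x := B.colour c x.down
  le_refl x := B.le_refl x.down
  le_trans x y z := B.le_trans x.down y.down z.down
  le_total x y := B.le_total x.down y.down
  le_antisymm x y h h' := ULift.ext _ _ (B.le_antisymm x.down y.down h h')

/-- Needed because `AugmentableRight` fixes a universe for `B` larger than that of `above f`. -/
theorem AugmentableRightBy.ulift {A : ColouredMultiOrder.{u, v, w} P K}
    {B : ColouredMultiOrder.{u, v, w₁} P K} (h : A.AugmentableRightBy B) :
    A.AugmentableRightBy (ColouredMultiOrder.ulift.{u, v, w₁, w₂} B) := by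
  refine IsElementary.comp (B := A.add B) (C := A.add (ColouredMultiOrder.ulift B))
    (g := fun p => Sum.map id ULift.up) ?_ h
  refine isElementary_of_surjective _ ?_ ?_ ?_
  · rintro p q (x | x) (y | y) <;> exact Iff.rfl
  · rintro p c (x | x) <;> exact Iff.rfl
  · rintro p (x | x)
    · exact ⟨.inl x, rfl⟩
    · exact ⟨.inr x.down, rfl⟩

theorem augmentableRight_iff (A : ColouredMultiOrder.{u, v, w} P K) (hA : A.IsNonempty) :
    A.AugmentableRight ↔ ∃ p : P, ¬ A.BoundedRight p := by
  constructor
  · rintro ⟨B, ⟨p, ⟨b⟩⟩, hB⟩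
    refine ⟨p, fun ⟨q, a, ha⟩ => ?_⟩
    exact (hB [q] (.all p (.le .zero (.succ .zero)))
      (Assignment.cons a (Assignment.nil A))).2 ha (.inr b)
  · rintro ⟨p, hp⟩
    obtain ⟨M, f, hf, b, hb⟩ := A.exists_isElementary_above hA hp
    have h : A.AugmentableRightBy (above f) :=
      IsElementary.of_comp (isElementary_addAbove hf) hf
    exact ⟨ulift.{u, v, w, max u v} (above f), ⟨p, ⟨⟨⟨b, hb⟩⟩⟩⟩, h.ulift⟩

/-! ### Duality -/

/-- The multi-order with all relations reversed. -/
def op (A : ColouredMultiOrder.{u, v, w} P K) : ColouredMultiOrder.{u, v, w} P K where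
  Carrier := A.Carrier
  le x y := A.le y x
  colour := A.colour
  le_refl := A.le_refl
  le_trans x y z h h' := A.le_trans z y x h' h
  le_total x y := A.le_total y x
  le_antisymm x y h h' := A.le_antisymm x y h' h

theorem realize_op (A : ColouredMultiOrder.{u, v, w} P K) {Γ : List P} (φ : Formula K Γ)
    (s : A.Assignment Γ) : A.op.Realize φ s ↔ A.Realize φ.op s := by
  induction φ with
  | falsum => exact Iff.rfl
  | equal x y => exact Iff.rfl
  | le x y => exact Iff.rfl
  | colour c x => exact Iff.rfl
  | imp φ ψ ihφ ihψ => exact imp_congr (ihφ s) (ihψ s)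
  | all p φ ih => exact forall_congr' fun a => ih (Assignment.cons (A := A) a s)

theorem IsElementary.op {A : ColouredMultiOrder.{u, v, w₁} P K}
    {B : ColouredMultiOrder.{u, v, w₂} P K} {f : ∀ p : P, A.Carrier p → B.Carrier p}
    (h : IsElementary A B f) : IsElementary A.op B.op f :=
  fun Γ φ s => (B.realize_op φ _).trans ((h Γ φ.op s).trans (A.realize_op φ s).symm)

theorem isElementary_swap (A : ColouredMultiOrder.{u, v, w₁} P K)
    (B : ColouredMultiOrder.{u, v, w₂} P K) :
    IsElementary (A.add B).op (B.op.add A.op) (fun _ => Sum.swap) := by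
  refine isElementary_of_surjective _ ?_ ?_ ?_
  · rintro p q (x | x) (y | y) <;> exact Iff.rfl
  · rintro p c (x | x) <;> exact Iff.rfl
  · exact fun p => Sum.swap_rightInverse.surjective

theorem augmentableLeft_iff_op (A : ColouredMultiOrder.{u, v, w} P K) :
    A.AugmentableLeft ↔ A.op.AugmentableRight := by
  constructor
  · rintro ⟨B, hB, h⟩
    exact ⟨B.op, hB, (isElementary_swap B A).comp h.op⟩
  · rintro ⟨B, hB, h⟩
    -- `A.op.op` is `A` by definition.
    exact ⟨B.op, hB, (isElementary_swap A.op B).comp h.op⟩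

end ColouredMultiOrder

theorem mainTheorem7 {P : Type u} {K : P → Type v} (A : ColouredMultiOrder.{u, v, w} P K)
    (hA : A.IsNonempty) :
    (A.AugmentableRight ↔ ∃ p : P, ¬ A.BoundedRight p) ∧
      (A.AugmentableLeft ↔ ∃ p : P, ¬ A.BoundedLeft p) :=
  ⟨A.augmentableRight_iff hA, A.augmentableLeft_iff_op.trans (A.op.augmentableRight_iff hA)⟩
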